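/- A random graph on $n$ vertices is called \emph{$d$-dependent with edge probability $q$} if each of the $\binom n2$ potential edges is present with probability $q$, and there is a graph $H$ of maximum degree at most $d$, whose vertices are the potential edges, such that for every potential edge $e$ the indicator $X_e$ of the presence of $e$ is independent of the family $\{X_f : f\neq e,\ \{e,f\}\notin H\}$. Write $G(n,q,d)$ for an arbitrary such random graph and $\chi$ for the chromatic number. \textbf{Theorem.} Let $0<\varepsilon<1/8$ and let $\eta:\mathbb N\to\mathbb R$ satisfy $\eta(n)\to 0$. There is an $n_0$, depending only on $\varepsilon$ and $\eta$, such that for all $n\ge n_0$, all $q$ with $3/4<q<1-n^{-\varepsilon/4}$, all integers $d\ge 0$ with $d\le n^{\eta(n)}$ (that is, $d\le n^{o(1)}$), and every $d$-dependent random graph $G(n,q,d)$ with edge probability $q$, $$\Pr\left[\chi(G(n,q,d)) < (1+4\varepsilon)\,\frac{-n\log(1-q)}{\log n}\right] > 1-\exp\left(-n^{1+\varepsilon}\right).$$ -/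

import Mathlib

open MeasureTheory ProbabilityTheory Filter Topology

namespace DependentRandomGraph

/-- `H` is a dependency graph for the family of random variables `X` (under `P`): each `X i` is
independent of the whole family of those `X j`, `j ≠ i`, for which `j` is not a neighbour
of `i` in `H`. -/
def IsDependencyGraph {Ω ι β : Type*} [MeasurableSpace Ω] [MeasurableSpace β]
    (P : Measure Ω) (X : ι → Ω → β) (H : SimpleGraph ι) : Prop :=
  ∀ i : ι, IndepFun (X i) (fun ω (j : {j : ι // j ≠ i ∧ ¬ H.Adj i j}) => X j ω) P

/-- The family `X` is `d`-locally dependent: it has a dependency graph all of whose vertices have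
degree at most `d`. -/
def LocallyDependent {Ω ι β : Type*} [MeasurableSpace Ω] [MeasurableSpace β]
    (P : Measure Ω) (d : ℕ) (X : ι → Ω → β) : Prop :=
  ∃ H : SimpleGraph ι, (∀ i, (H.neighborSet i).encard ≤ d) ∧ IsDependencyGraph P X H

/-- The potential edges of a graph on `V`: unordered pairs of distinct vertices. -/
abbrev PotentialEdge (V : Type*) : Type _ := {e : Sym2 V // ¬ e.IsDiag}

/-- The (truth-valued) indicator variable of the presence of the potential edge `e` in the random
graph `G`. -/
def edgeIndicator {Ω V : Type*} (G : Ω → SimpleGraph V) (e : PotentialEdge V) : Ω → Prop :=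
  fun ω => (e : Sym2 V) ∈ (G ω).edgeSet

/-- `G` is a `d`-dependent random graph with edge probability `q`: every potential edge is present
with probability `q`, and the edge indicators are `d`-locally dependent. -/
structure IsDependentRandomGraph {Ω V : Type*} [MeasurableSpace Ω] (P : Measure Ω)
    (q : ℝ) (d : ℕ) (G : Ω → SimpleGraph V) : Prop where
  measurable_edge : ∀ e : PotentialEdge V, Measurable (edgeIndicator G e)
  edge_prob : ∀ e : PotentialEdge V, P.real {ω | edgeIndicator G e ω} = q
  locallyDependent : LocallyDependent P d (edgeIndicator G)

/-- The chromatic number of a graph, as a natural number; it is used for finite graphs only. -/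
noncomputable def chi {V : Type*} (G : SimpleGraph V) : ℕ := G.chromaticNumber.toNat

/-- On a finite graph no information is lost in passing from `ℕ∞` to `ℕ`. -/
theorem coe_chi {V : Type*} [Finite V] (G : SimpleGraph V) :
    (chi G : ℕ∞) = G.chromaticNumber := by
  have := Fintype.ofFinite V
  exact ENat.natCast_toNat (SimpleGraph.chromaticNumber_ne_top_iff_exists.2
    ⟨_, G.colorable_of_fintype⟩)

end DependentRandomGraph

/-!
The number of colours is that of a greedy colouring by independent sets of size
`k ≈ (1 - 2ε) log n / log (1 / (1 - q))`: if every set of `m = n ^ (1 - ε / 8)` vertices contains an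
independent `k`-set, then `n / k + m` colours suffice (`chi_le_of_indepSets`). It remains to see that
a fixed `m`-set `U` contains no independent `k`-set with probability at most `2 ^ (-t)`, where
`t ≈ 4 n ^ (1 + ε)`; this beats the union bound over the at most `2 ^ n` sets `U`.

The size `k` is about half of the largest one that would be possible, so that an independent `k`-set
is already to be expected inside a block `W ⊆ U` of only `s = n ^ (1 / 2 - 3ε / 4)` vertices: by the
second moment method a block contains one with probability at least `1 / 2`
(`IsDependencyGraph.measureReal_no_absent_le`). As `s ^ 2 t` is much smaller than `m ^ 2`, there is
room for `t` such blocks with almost no interaction.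

Dependence is removed before any probability is computed. A dependency graph `H` in the present
sense does not make two families without `H`-edges between them independent, but it does make a
family indexed by an independent set of `H` mutually independent
(`IsDependencyGraph.measure_biInter`). So the blocks are chosen one after the other in such a way
that at least half of the `k`-subsets of the new block `W` contain no pair that is already in use, is
an `H`-neighbour of a pair in use, or has an `H`-neighbour inside `W`. Such a `W` exists since a
uniformly random `s`-subset of `U` contains few of these pairs on average (`exists_block`). With only
those `k`-subsets admitted, all pairs that matter form an independent set of `H`, the failures of the
blocks are independent events, and their probabilities multiply
(`IsDependencyGraph.exists_event_of_blocks`).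
-/

namespace DependentRandomGraph

/-! ### Counting subsets -/

theorem choose_sub_mul_pow_le (m s a : ℕ) (ha : a ≤ s) (hs : s ≤ m) :
    (m - a).choose (s - a) * m ^ a ≤ m.choose s * s ^ a := by
  induction a with
  | zero => simp
  | succ a ih =>
    have h1 := ih (by omega)
    obtain ⟨x, hx⟩ : ∃ x, m - a = x + 1 := ⟨m - a - 1, by omega⟩
    obtain ⟨y, hy⟩ : ∃ y, s - a = y + 1 := ⟨s - a - 1, by omega⟩
    have e1 : m - (a + 1) = x := by omega
    have e2 : s - (a + 1) = y := by omega
    rw [e1, e2]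
    rw [hx, hy] at h1
    have h2 := Nat.add_one_mul_choose_eq x y
    have h3 : m * (y + 1) ≤ s * (x + 1) := by
      obtain rfl : m = x + 1 + a := by omega
      obtain rfl : s = y + 1 + a := by omega
      have : y ≤ x := by omega
      nlinarith [Nat.mul_le_mul_left a this]
    have h4 : (x + 1) * (x.choose y * m ^ (a + 1)) ≤ (x + 1) * (m.choose s * s ^ (a + 1)) := by
      calc (x + 1) * (x.choose y * m ^ (a + 1))
          = ((x + 1) * x.choose y) * m ^ a * m := by ring
        _ = (x + 1).choose (y + 1) * m ^ a * (m * (y + 1)) := by rw [h2]; ring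
        _ ≤ (m.choose s * s ^ a) * (s * (x + 1)) := Nat.mul_le_mul h1 h3
        _ = _ := by ring
    exact Nat.le_of_mul_le_mul_left h4 (Nat.succ_pos x)

theorem card_filter_superset_mul_le {V : Type*} [DecidableEq V] (U A : Finset V) (s : ℕ) :
    ((U.powersetCard s).filter (A ⊆ ·)).card * U.card ^ A.card
      ≤ U.card.choose s * s ^ A.card := by
  by_cases hne : ((U.powersetCard s).filter (A ⊆ ·)).Nonempty
  · obtain ⟨W, hW⟩ := hne
    simp only [Finset.mem_filter, Finset.mem_powersetCard] at hW
    have hAU : A ⊆ U := hW.2.trans hW.1.1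
    have h1 : A.card ≤ s := hW.1.2 ▸ Finset.card_le_card hW.2
    have h2 : s ≤ U.card := hW.1.2 ▸ Finset.card_le_card hW.1.1
    have h3 : ((U.powersetCard s).filter (A ⊆ ·)).card
        ≤ ((U \ A).powersetCard (s - A.card)).card := by
      apply Finset.card_le_card_of_injOn (fun W => W \ A)
      · intro W hW
        simp only [Finset.coe_filter, Finset.mem_powersetCard, Set.mem_ofPred_eq] at hW
        simp only [Finset.mem_coe, Finset.mem_powersetCard]
        exact ⟨Finset.sdiff_subset_sdiff hW.1.1 le_rfl,
          by rw [Finset.card_sdiff_of_subset hW.2, hW.1.2]⟩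
      · intro W hW W' hW' h
        simp only [Finset.coe_filter, Finset.mem_powersetCard, Set.mem_ofPred_eq] at hW hW'
        rw [← Finset.sdiff_union_of_subset hW.2, ← Finset.sdiff_union_of_subset hW'.2]
        exact congrArg (· ∪ A) h
    rw [Finset.card_powersetCard, Finset.card_sdiff_of_subset hAU] at h3
    exact (Nat.mul_le_mul_right _ h3).trans (choose_sub_mul_pow_le _ _ _ h1 h2)
  · rw [Finset.not_nonempty_iff_eq_empty.1 hne]; simp

/-- A fixed set `A` lies in a random `s`-subset of `U` with probability at most
`(s / |U|) ^ |A|`. -/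
theorem card_filter_superset_le {V : Type*} [DecidableEq V] (U A : Finset V) (s : ℕ)
    (hU : 0 < U.card) :
    (((U.powersetCard s).filter (A ⊆ ·)).card : ℝ)
      ≤ U.card.choose s * ((s : ℝ) / U.card) ^ A.card := by
  have h := card_filter_superset_mul_le U A s
  rw [div_pow, ← mul_div_assoc, le_div_iff₀ (by positivity)]
  exact_mod_cast h

/-! ### Potential edges inside a vertex set -/

/-- The potential edges both of whose endpoints lie in `S`. -/
def edgesIn {V : Type*} [Fintype V] [DecidableEq V] (S : Finset V) :
    Finset (PotentialEdge V) :=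
  Finset.univ.filter fun e => (e : Sym2 V).toFinset ⊆ S

section
variable {V : Type*} [DecidableEq V]

theorem toFinset_injective : Function.Injective (fun e : Sym2 V => e.toFinset) := by
  intro e f h
  apply Sym2.ext
  intro x
  rw [← Sym2.mem_toFinset, ← Sym2.mem_toFinset]
  exact iff_of_eq (congrArg (x ∈ ·) h)

theorem card_toFinset (e : PotentialEdge V) : (e : Sym2 V).toFinset.card = 2 :=
  Sym2.card_toFinset_of_not_isDiag _ e.2

theorem three_le_card_union {e f : PotentialEdge V} (h : e ≠ f) :
    3 ≤ ((e : Sym2 V).toFinset ∪ (f : Sym2 V).toFinset).card := by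
  by_contra! hlt
  have h1 : (e : Sym2 V).toFinset = (e : Sym2 V).toFinset ∪ (f : Sym2 V).toFinset :=
    Finset.eq_of_subset_of_card_le Finset.subset_union_left (by rw [card_toFinset]; omega)
  have h2 : (f : Sym2 V).toFinset = (e : Sym2 V).toFinset ∪ (f : Sym2 V).toFinset :=
    Finset.eq_of_subset_of_card_le Finset.subset_union_right (by rw [card_toFinset]; omega)
  exact h (Subtype.ext (toFinset_injective (h1.trans h2.symm)))

variable [Fintype V]

theorem mem_edgesIn {S : Finset V} {e : PotentialEdge V} :
    e ∈ edgesIn S ↔ (e : Sym2 V).toFinset ⊆ S := by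
  simp [edgesIn]

theorem edgesIn_inter (S T : Finset V) : edgesIn (S ∩ T) = edgesIn S ∩ edgesIn T := by
  ext e; simp [mem_edgesIn, Finset.subset_inter_iff]

theorem edgesIn_mono {S T : Finset V} (h : S ⊆ T) : edgesIn S ⊆ edgesIn T :=
  fun _ he => mem_edgesIn.2 ((mem_edgesIn.1 he).trans h)

theorem card_edgesIn (S : Finset V) : (edgesIn S).card = S.card.choose 2 := by
  rw [← Finset.card_powersetCard]
  apply Finset.card_bij (fun (e : PotentialEdge V) _ => (e : Sym2 V).toFinset)
  · intro e he
    exact Finset.mem_powersetCard.2 ⟨mem_edgesIn.1 he, card_toFinset e⟩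
  · intro e _ f _ h
    exact Subtype.ext (toFinset_injective h)
  · intro T hT
    obtain ⟨hTS, hT2⟩ := Finset.mem_powersetCard.1 hT
    obtain ⟨x, y, hxy, rfl⟩ := Finset.card_eq_two.1 hT2
    refine ⟨⟨s(x, y), by simpa using hxy⟩, ?_, ?_⟩
    · rw [mem_edgesIn]; simpa [Sym2.toFinset_mk_eq] using hTS
    · simp [Sym2.toFinset_mk_eq]

theorem card_edgesIn_le (S : Finset V) : (edgesIn S).card ≤ S.card ^ 2 := by
  rw [card_edgesIn]; exact Nat.choose_le_pow _ _

theorem card_edgesIn_union (S T : Finset V) :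
    (edgesIn S ∪ edgesIn T).card + (S ∩ T).card.choose 2
      = S.card.choose 2 + T.card.choose 2 := by
  rw [← card_edgesIn, edgesIn_inter, Finset.card_union_add_card_inter, card_edgesIn, card_edgesIn]

end

/-! ### Colouring by removing independent sets -/

/-- If every `m`-set of vertices contains an independent `k`-set, repeatedly removing independent
`k`-sets until at most `m` vertices are left, and giving these colours of their own, colours the
graph with at most `n / k + m` colours. -/
theorem exists_coloring_of_indepSets {V : Type*} [DecidableEq V] (G : SimpleGraph V)
    (k m : ℕ) (hk : 0 < k)
    (h : ∀ U : Finset V, U.card = m → ∃ S ⊆ U, S.card = k ∧ G.IsIndepSet (S : Set V)) :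
    ∀ (N : ℕ) (A : Finset V), A.card ≤ N → ∃ (C : ℕ) (c : V → ℕ), k * C ≤ A.card + k * m ∧
      (∀ v ∈ A, c v < C) ∧ ∀ v ∈ A, ∀ w ∈ A, G.Adj v w → c v ≠ c w := by
  intro N
  induction N with
  | zero =>
    intro A hA
    obtain rfl : A = ∅ := by simpa using hA
    exact ⟨0, fun _ => 0, by simp, by simp, by simp⟩
  | succ N ih =>
    intro A hA
    rcases le_or_gt A.card m with hm | hm
    · refine ⟨A.card, fun v => if hv : v ∈ A then A.equivFin ⟨v, hv⟩ else 0, ?_, ?_, ?_⟩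
      · nlinarith
      · intro v hv; simp [hv]
      · intro v hv w hw hvw heq
        simp only [hv, hw, dif_pos] at heq
        have := A.equivFin.injective (Fin.ext heq)
        exact hvw.ne (congrArg Subtype.val this)
    · obtain ⟨U, hUA, hU⟩ := Finset.exists_subset_card_eq hm.le
      obtain ⟨S, hSU, hS, hind⟩ := h U hU
      have hSA := hSU.trans hUA
      have hcard : (A \ S).card + k = A.card := by
        rw [← hS]; exact Finset.card_sdiff_add_card_eq_card hSA
      obtain ⟨C, c, h1, h2, h3⟩ := ih (A \ S) (by omega)
      refine ⟨C + 1, fun v => if v ∈ S then C else c v, by rw [mul_add]; omega, ?_, ?_⟩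
      · intro v hv
        by_cases hvS : v ∈ S
        · simp [hvS]
        · simpa [hvS] using (h2 v (by simp [hv, hvS])).trans (Nat.lt_succ_self C)
      · intro v hv w hw hvw
        by_cases hvS : v ∈ S <;> by_cases hwS : w ∈ S
        · exact absurd hvw (hind hvS hwS hvw.ne)
        · simpa [hvS, hwS] using (h2 w (by simp [hw, hwS])).ne'
        · simpa [hvS, hwS] using (h2 v (by simp [hv, hvS])).ne
        · simpa [hvS, hwS] using h3 v (by simp [hv, hvS]) w (by simp [hw, hwS]) hvw

theorem chi_le_of_indepSets {n : ℕ} (G : SimpleGraph (Fin n)) (k m : ℕ) (hk : 0 < k)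
    (h : ∀ U : Finset (Fin n), U.card = m →
      ∃ S ⊆ U, S.card = k ∧ G.IsIndepSet (S : Set (Fin n))) :
    (chi G : ℝ) ≤ n / k + m := by
  obtain ⟨C, c, h1, h2, h3⟩ :=
    exists_coloring_of_indepSets G k m hk h n Finset.univ (by simp)
  have hC : G.Colorable C :=
    ⟨SimpleGraph.Coloring.mk (fun v => (⟨c v, h2 v (Finset.mem_univ v)⟩ : Fin C))
      (fun {v w} hvw heq => h3 v (Finset.mem_univ v) w (Finset.mem_univ w) hvw
        (congrArg Fin.val heq))⟩
  have h4 : chi G ≤ C := by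
    have := hC.chromaticNumber_le
    rw [← coe_chi] at this
    exact_mod_cast this
  have h5 : (k : ℝ) * C ≤ n + k * m := by
    have := h1
    rw [Finset.card_univ, Fintype.card_fin] at this
    exact_mod_cast this
  have hk' : (0 : ℝ) < k := by exact_mod_cast hk
  calc (chi G : ℝ) ≤ C := by exact_mod_cast h4
    _ ≤ (n + k * m) / k := by rw [le_div_iff₀ hk']; linarith
    _ = n / k + m := by field_simp

/-! ### Independence along independent sets of the dependency graph -/

section
variable {Ω ι β : Type*} [MeasurableSpace β] {X : ι → Ω → β}

/-- The σ-algebra generated by the variables with index in `A`. -/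
abbrev sigmaOf (X : ι → Ω → β) (A : Finset ι) : MeasurableSpace Ω :=
  ⨆ i ∈ (A : Set ι), MeasurableSpace.comap (X i) inferInstance

theorem sigmaOf_mono {A B : Finset ι} (h : A ⊆ B) : sigmaOf X A ≤ sigmaOf X B :=
  biSup_mono fun _ hi => h hi

theorem measurableSet_sigmaOf {A : Finset ι} {i : ι} (hi : i ∈ A) {B : Set β}
    (hB : MeasurableSet B) : MeasurableSet[sigmaOf X A] (X i ⁻¹' B) :=
  (le_iSup₂_of_le (f := fun i (_ : i ∈ (A : Set ι)) =>
    MeasurableSpace.comap (X i) inferInstance) i hi le_rfl) _ ⟨B, hB, rfl⟩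

variable [MeasurableSpace Ω] {P : Measure Ω} {H : SimpleGraph ι}

/-- Variables indexed by an independent set of the dependency graph are mutually independent. -/
theorem IsDependencyGraph.measure_biInter [IsProbabilityMeasure P] (h : IsDependencyGraph P X H)
    (s : Finset ι) (hs : ∀ i ∈ s, ∀ j ∈ s, ¬ H.Adj i j) (B : ι → Set β)
    (hB : ∀ i ∈ s, MeasurableSet (B i)) :
    P (⋂ i ∈ s, X i ⁻¹' B i) = ∏ i ∈ s, P (X i ⁻¹' B i) := by
  classical
  induction s using Finset.induction_on with
  | empty => simp
  | insert a s ha ih =>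
    rw [Finset.prod_insert ha, ← ih (fun i hi j hj => hs i (Finset.mem_insert_of_mem hi) j
        (Finset.mem_insert_of_mem hj)) (fun i hi => hB i (Finset.mem_insert_of_mem hi)),
      Finset.set_biInter_insert]
    have hmem : ∀ j ∈ s, j ≠ a ∧ ¬ H.Adj a j := fun j hj =>
      ⟨fun hja => ha (hja ▸ hj), hs a (Finset.mem_insert_self _ _) j (Finset.mem_insert_of_mem hj)⟩
    have key := (h a).measure_inter_preimage_eq_mul (B a)
      (⋂ j ∈ s.attach, (fun x : {j : ι // j ≠ a ∧ ¬ H.Adj a j} → β =>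
        x ⟨j, hmem j j.2⟩) ⁻¹' B j) (hB a (Finset.mem_insert_self _ _))
      (Finset.measurableSet_biInter _ fun j _ =>
        measurable_pi_apply _ (hB j (Finset.mem_insert_of_mem j.2)))
    have hset : (fun ω (j : {j : ι // j ≠ a ∧ ¬ H.Adj a j}) => X j ω) ⁻¹'
        (⋂ j ∈ s.attach, (fun x : {j : ι // j ≠ a ∧ ¬ H.Adj a j} → β =>
        x ⟨j, hmem j j.2⟩) ⁻¹' B j) = ⋂ i ∈ s, X i ⁻¹' B i := by
      ext ω; simp
    rwa [hset] at key

theorem sigmaOf_le (hX : ∀ i, Measurable (X i)) (A : Finset ι) :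
    sigmaOf X A ≤ ‹MeasurableSpace Ω› :=
  iSup₂_le fun i _ => (hX i).comap_le

theorem IsDependencyGraph.indep_sigmaOf [DecidableEq ι] [IsProbabilityMeasure P]
    (hX : ∀ i, Measurable (X i)) (h : IsDependencyGraph P X H) {A E : Finset ι}
    (hAE : Disjoint A E) (hind : ∀ i ∈ A ∪ E, ∀ j ∈ A ∪ E, ¬ H.Adj i j) :
    Indep (sigmaOf X A) (sigmaOf X E) P := by
  classical
  have hpi : ∀ S : Finset ι, IsPiSystem (piiUnionInter (fun i =>
      {s | MeasurableSet[MeasurableSpace.comap (X i) inferInstance] s}) (S : Set ι)) := fun S =>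
    isPiSystem_piiUnionInter _
      (fun i => @MeasurableSpace.isPiSystem_measurableSet Ω (MeasurableSpace.comap (X i) _)) _
  refine IndepSets.indep (sigmaOf_le hX A) (sigmaOf_le hX E) (hpi A) (hpi E)
    (generateFrom_piiUnionInter_measurableSet _ _).symm
    (generateFrom_piiUnionInter_measurableSet _ _).symm ?_
  rw [IndepSets_iff]
  rintro _ _ ⟨u, hu, f, hf, rfl⟩ ⟨v, hv, g, hg, rfl⟩
  have hu' : u ⊆ A := by exact_mod_cast hu
  have hv' : v ⊆ E := by exact_mod_cast hv
  have huv : Disjoint u v := Finset.disjoint_of_subset_left hu'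
    (Finset.disjoint_of_subset_right hv' hAE)
  have hf' : ∀ i, ∃ B : Set β, MeasurableSet B ∧ (i ∈ u → X i ⁻¹' B = f i) := fun i => by
    by_cases hi : i ∈ u
    · obtain ⟨B, hB, e⟩ := hf i hi
      exact ⟨B, hB, fun _ => e⟩
    · exact ⟨∅, MeasurableSet.empty, fun h => absurd h hi⟩
  have hg' : ∀ i, ∃ B : Set β, MeasurableSet B ∧ (i ∈ v → X i ⁻¹' B = g i) := fun i => by
    by_cases hi : i ∈ v
    · obtain ⟨B, hB, e⟩ := hg i hi
      exact ⟨B, hB, fun _ => e⟩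
    · exact ⟨∅, MeasurableSet.empty, fun h => absurd h hi⟩
  choose B hB hBf using hf'
  choose D hD hDg using hg'
  have hsub : ∀ {w : Finset ι}, w ⊆ A ∪ E → ∀ i ∈ w, ∀ j ∈ w, ¬ H.Adj i j :=
    fun hw i hi j hj => hind i (hw hi) j (hw hj)
  have e1 : (⋂ i ∈ u, f i) = ⋂ i ∈ u, X i ⁻¹' B i :=
    Set.iInter₂_congr fun i hi => (hBf i hi).symm
  have e2 : (⋂ i ∈ v, g i) = ⋂ i ∈ v, X i ⁻¹' D i :=
    Set.iInter₂_congr fun i hi => (hDg i hi).symm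
  have key := h.measure_biInter (u ∪ v) (hsub (Finset.union_subset_union hu' hv'))
    (fun i => if i ∈ u then B i else D i)
    (fun i _ => by split_ifs; exacts [hB i, hD i])
  have c1 : ∀ i ∈ u, X i ⁻¹' (if i ∈ u then B i else D i) = X i ⁻¹' B i :=
    fun i hi => by rw [if_pos hi]
  have c2 : ∀ i ∈ v, X i ⁻¹' (if i ∈ u then B i else D i) = X i ⁻¹' D i :=
    fun i hi => by rw [if_neg (Finset.disjoint_right.1 huv hi)]
  have hinter : (⋂ i ∈ u ∪ v, X i ⁻¹' (if i ∈ u then B i else D i))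
      = (⋂ i ∈ u, X i ⁻¹' (if i ∈ u then B i else D i))
        ∩ ⋂ i ∈ v, X i ⁻¹' (if i ∈ u then B i else D i) := by
    ext ω; simp only [Set.mem_iInter, Finset.mem_union, or_imp, forall_and, Set.mem_inter_iff]
  rw [Finset.prod_union huv, hinter,
    Finset.prod_congr rfl fun i hi => congrArg P (c1 i hi),
    Finset.prod_congr rfl fun i hi => congrArg P (c2 i hi),
    Set.iInter₂_congr c1, Set.iInter₂_congr c2] at key
  rw [e1, e2, key,
    h.measure_biInter u (hsub (hu'.trans Finset.subset_union_left)) B fun i _ => hB i,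
    h.measure_biInter v (hsub (hv'.trans Finset.subset_union_right)) D fun i _ => hD i]

end

/-! ### The second moment method -/

/-- Chebyshev's inequality for the number of events that occur. -/
theorem measureReal_iInter_compl_le {Ω α : Type*} [MeasurableSpace Ω] {P : Measure Ω}
    [IsProbabilityMeasure P] (S : Finset α) (hS : S.Nonempty) (E : α → Set Ω)
    (hE : ∀ a, MeasurableSet (E a)) (π δ : ℝ) (hπ : 0 < π) (h1 : ∀ a ∈ S, P.real (E a) = π)
    (h2 : ∑ a ∈ S, ∑ b ∈ S, P.real (E a ∩ E b) ≤ (1 + δ) * (S.card * π) ^ 2) :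
    P.real (⋂ a ∈ S, (E a)ᶜ) ≤ δ := by
  set N : Ω → ℝ := fun ω => ∑ a ∈ S, (E a).indicator 1 ω with hN
  set μ : ℝ := S.card * π with hμ
  have hμ0 : 0 < μ := mul_pos (by exact_mod_cast hS.card_pos) hπ
  have hint : ∀ A : Set Ω, MeasurableSet A → Integrable (A.indicator (1 : Ω → ℝ)) P :=
    fun A hA => (integrable_const (1 : ℝ)).indicator hA
  have hNint : Integrable N P := integrable_finsetSum _ fun a _ => hint _ (hE a)
  have hN1 : ∫ ω, N ω ∂P = μ := by
    rw [hN, integral_finsetSum _ fun a _ => hint _ (hE a),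
      Finset.sum_congr rfl fun a ha => (integral_indicator_one (hE a)).trans (h1 a ha)]
    simp [hμ]
  have hsq : (fun ω => N ω ^ 2) =
      fun ω => ∑ a ∈ S, ∑ b ∈ S, (E a ∩ E b).indicator (1 : Ω → ℝ) ω := by
    funext ω
    rw [hN, sq, Finset.sum_mul_sum]
    refine Finset.sum_congr rfl fun a _ => Finset.sum_congr rfl fun b _ => ?_
    rw [Set.inter_indicator_one]; rfl
  have hint2 : ∀ a ∈ S, ∀ b ∈ S, Integrable ((E a ∩ E b).indicator (1 : Ω → ℝ)) P :=
    fun a _ b _ => hint _ ((hE a).inter (hE b))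
  have hN2int : Integrable (fun ω => N ω ^ 2) P := by
    rw [hsq]
    exact integrable_finsetSum _ fun a ha => integrable_finsetSum _ fun b hb => hint2 a ha b hb
  have hN2 : ∫ ω, N ω ^ 2 ∂P ≤ (1 + δ) * μ ^ 2 := by
    rw [hsq, integral_finsetSum _ fun a ha => integrable_finsetSum _ fun b hb => hint2 a ha b hb]
    refine le_of_eq_of_le (Finset.sum_congr rfl fun a ha => ?_) h2
    rw [integral_finsetSum _ fun b hb => hint2 a ha b hb]
    exact Finset.sum_congr rfl fun b _ => integral_indicator_one ((hE a).inter (hE b))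
  have hexp : (fun ω => (N ω - μ) ^ 2) = fun ω => N ω ^ 2 - 2 * μ * N ω + μ ^ 2 := by
    funext ω; ring
  have hI : ∫ ω, (N ω - μ) ^ 2 ∂P ≤ δ * μ ^ 2 := by
    have hadd : ∫ ω, (N ω ^ 2 - 2 * μ * N ω + μ ^ 2) ∂P
        = ∫ ω, (N ω ^ 2 - 2 * μ * N ω) ∂P + ∫ _, μ ^ 2 ∂P :=
      integral_add (hN2int.sub (hNint.const_mul _)) (integrable_const _)
    rw [hexp, hadd, integral_sub hN2int (hNint.const_mul _), integral_const_mul, hN1]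
    simp only [integral_const, probReal_univ, smul_eq_mul, one_mul]
    nlinarith
  have hM := mul_meas_ge_le_integral_of_nonneg (μ := P) (f := fun ω => (N ω - μ) ^ 2)
    (Eventually.of_forall fun ω => sq_nonneg _)
    (by rw [hexp]; exact (hN2int.sub (hNint.const_mul _)).add (integrable_const _)) (μ ^ 2)
  have hsub : P.real (⋂ a ∈ S, (E a)ᶜ) ≤ P.real {ω | μ ^ 2 ≤ (N ω - μ) ^ 2} := by
    refine measureReal_mono fun ω hω => ?_
    have : N ω = 0 := Finset.sum_eq_zero fun a ha => by
      simp only [Set.mem_iInter] at hω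
      exact Set.indicator_of_notMem (hω a ha) _
    simp [this]
  have h3 : μ ^ 2 * P.real (⋂ a ∈ S, (E a)ᶜ) ≤ μ ^ 2 * δ :=
    (mul_le_mul_of_nonneg_left hsub (sq_nonneg _)).trans (by linarith)
  exact le_of_mul_le_mul_left h3 (by positivity)

/-! ### Independent sets in a block -/

/-- The event that none of the potential edges in `Q` is present. -/
def absent {Ω ι : Type*} (X : ι → Ω → Prop) (Q : Finset ι) : Set Ω :=
  ⋂ e ∈ Q, X e ⁻¹' {False}

section
variable {Ω ι : Type*} {X : ι → Ω → Prop}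

theorem mem_absent {Q : Finset ι} {ω : Ω} : ω ∈ absent X Q ↔ ∀ e ∈ Q, ¬ X e ω := by
  simp [absent]

theorem absent_union [DecidableEq ι] (Q R : Finset ι) :
    absent X (Q ∪ R) = absent X Q ∩ absent X R := by
  ext ω
  simp only [mem_absent, Finset.mem_union, or_imp, forall_and, Set.mem_inter_iff]

theorem measurableSet_sigmaOf_absent {Q A : Finset ι} (h : Q ⊆ A) :
    MeasurableSet[sigmaOf X A] (absent X Q) :=
  Finset.measurableSet_biInter _ fun _ he =>
    measurableSet_sigmaOf (h he) (MeasurableSet.singleton _)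

variable [MeasurableSpace Ω] {P : Measure Ω} [IsProbabilityMeasure P] {H : SimpleGraph ι}

theorem IsDependencyGraph.measureReal_absent (h : IsDependencyGraph P X H)
    (hX : ∀ e, Measurable (X e)) {q : ℝ} (hq : ∀ e, P.real {ω | X e ω} = q) (Q : Finset ι)
    (hQ : ∀ e ∈ Q, ∀ f ∈ Q, ¬ H.Adj e f) : P.real (absent X Q) = (1 - q) ^ Q.card := by
  have h1 : ∀ e, P.real (X e ⁻¹' {False}) = 1 - q := fun e => by
    have hm : MeasurableSet {ω | X e ω} := measurableSet_setOfPred.2 (hX e)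
    rw [← hq e, ← probReal_compl_eq_one_sub hm]
    congr 1; ext ω; simp
  rw [absent, measureReal_def, h.measure_biInter Q hQ _ fun e _ => MeasurableSet.singleton _,
    ENNReal.toReal_prod, Finset.prod_congr rfl fun e _ => (measureReal_def P _).symm.trans (h1 e),
    Finset.prod_const]

end

section
variable {V : Type*} [DecidableEq V]

/-- The overlaps of a `k`-set `S` with the members of a family of `k`-subsets of `W`, each weighted
by `r` to the number of common pairs: a family member `T` meeting `S` in `I` is charged to `I`. -/
theorem sum_pow_choose_card_inter_le (W S : Finset V) (k : ℕ) (hW : 0 < W.card) (hS : S.card = k)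
    (𝒮 : Finset (Finset V)) (h𝒮 : 𝒮 ⊆ W.powersetCard k) (r : ℝ) (hr : 0 ≤ r) :
    ∑ T ∈ 𝒮, r ^ (S ∩ T).card.choose 2 ≤ 𝒮.card + W.card.choose k *
      ∑ v ∈ Finset.Icc 2 k, k.choose v * ((k : ℝ) / W.card) ^ v * r ^ v.choose 2 := by
  have hT : ∀ T ∈ 𝒮, r ^ (S ∩ T).card.choose 2 ≤ 1 + ∑ I ∈ S.powerset,
      if I ⊆ T then (if 2 ≤ I.card then r ^ I.card.choose 2 else 0) else 0 := by
    intro T _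
    have hnn : ∀ I ∈ S.powerset,
        0 ≤ if I ⊆ T then (if 2 ≤ I.card then r ^ I.card.choose 2 else 0) else 0 := by
      intro I _; split_ifs <;> positivity
    rcases le_or_gt 2 (S ∩ T).card with h2 | h2
    · have := Finset.single_le_sum hnn
        (Finset.mem_powerset.2 (Finset.inter_subset_left : S ∩ T ⊆ S))
      rw [if_pos Finset.inter_subset_right, if_pos h2] at this
      linarith
    · rw [Nat.choose_eq_zero_of_lt h2, pow_zero]
      linarith [Finset.sum_nonneg hnn]
  refine (Finset.sum_le_sum hT).trans ?_
  rw [Finset.sum_add_distrib, Finset.sum_comm]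
  simp only [Finset.sum_const, nsmul_eq_mul, mul_one]
  gcongr
  have hI : ∀ I ∈ S.powerset,
      (∑ T ∈ 𝒮, if I ⊆ T then (if 2 ≤ I.card then r ^ I.card.choose 2 else 0) else 0)
      ≤ W.card.choose k * (if 2 ≤ I.card then ((k : ℝ) / W.card) ^ I.card * r ^ I.card.choose 2
          else 0) := by
    intro I _
    rw [← Finset.sum_filter, Finset.sum_const, nsmul_eq_mul]
    split_ifs with h2
    · rw [← mul_assoc]
      gcongr
      refine le_trans ?_ (card_filter_superset_le W I k hW)
      exact_mod_cast Finset.card_le_card (Finset.filter_subset_filter _ h𝒮)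
    · simp
  refine (Finset.sum_le_sum hI).trans (le_of_eq ?_)
  rw [← Finset.mul_sum]
  congr 1
  rw [Finset.sum_powerset_apply_card
    (fun v => if 2 ≤ v then ((k : ℝ) / W.card) ^ v * r ^ v.choose 2 else 0), hS]
  have hIcc : Finset.Icc 2 k = (Finset.range (k + 1)).filter (2 ≤ ·) := by
    ext v; simp only [Finset.mem_Icc, Finset.mem_filter, Finset.mem_range]; omega
  rw [hIcc, Finset.sum_filter]
  refine Finset.sum_congr rfl fun v _ => ?_
  split_ifs <;> simp [mul_assoc]

variable [Fintype V] {Ω : Type*} [MeasurableSpace Ω] {P : Measure Ω} [IsProbabilityMeasure P]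
  {X : PotentialEdge V → Ω → Prop} {H : SimpleGraph (PotentialEdge V)}

/-- A family consisting of at least half of the `k`-subsets of `W`, all of whose pairs are mutually
independent, contains an independent set of the random graph with probability at least `1 / 2`. -/
theorem IsDependencyGraph.measureReal_no_absent_le (h : IsDependencyGraph P X H)
    (hX : ∀ e, Measurable (X e)) {q : ℝ} (hq : ∀ e, P.real {ω | X e ω} = q) (hq1 : q < 1)
    (W : Finset V) (k : ℕ) (hW : 0 < W.card) (hk : k ≤ W.card)
    (𝒮 : Finset (Finset V)) (h𝒮 : 𝒮 ⊆ W.powersetCard k)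
    (hind : ∀ S ∈ 𝒮, ∀ T ∈ 𝒮, ∀ e ∈ edgesIn S, ∀ f ∈ edgesIn T, ¬ H.Adj e f)
    (hcard : (W.card.choose k : ℝ) ≤ 2 * 𝒮.card)
    (hsum : ∑ v ∈ Finset.Icc 2 k, k.choose v * ((k : ℝ) / W.card) ^ v * (1 - q)⁻¹ ^ v.choose 2
      ≤ 1 / 4) :
    P.real (⋂ S ∈ 𝒮, (absent X (edgesIn S))ᶜ) ≤ 1 / 2 := by
  have hp : 0 < 1 - q := by linarith
  have hpos : (0 : ℝ) < W.card.choose k := by exact_mod_cast Nat.choose_pos hk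
  have hk𝒮 : ∀ S ∈ 𝒮, S.card = k := fun S hS => (Finset.mem_powersetCard.1 (h𝒮 hS)).2
  have hne : 𝒮.Nonempty := by
    rw [← Finset.card_pos]
    have : (0 : ℝ) < 𝒮.card := by linarith
    exact_mod_cast this
  refine measureReal_iInter_compl_le 𝒮 hne (fun S => absent X (edgesIn S))
    (fun S => sigmaOf_le hX _ _ (measurableSet_sigmaOf_absent le_rfl))
    ((1 - q) ^ k.choose 2) (1 / 2) (by positivity) ?_ ?_
  · intro S hS
    rw [h.measureReal_absent hX hq _ (hind S hS S hS), card_edgesIn, hk𝒮 S hS]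
  · have hST : ∀ S ∈ 𝒮, ∀ T ∈ 𝒮, P.real (absent X (edgesIn S) ∩ absent X (edgesIn T))
        = ((1 - q) ^ k.choose 2) ^ 2 * (1 - q)⁻¹ ^ (S ∩ T).card.choose 2 := by
      intro S hS T hT
      have hQ : ∀ e ∈ edgesIn S ∪ edgesIn T, ∀ f ∈ edgesIn S ∪ edgesIn T, ¬ H.Adj e f := by
        intro e he f hf
        rcases Finset.mem_union.1 he with he | he <;> rcases Finset.mem_union.1 hf with hf | hf
        exacts [hind S hS S hS e he f hf, hind S hS T hT e he f hf, hind T hT S hS e he f hf,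
          hind T hT T hT e he f hf]
      rw [← absent_union, h.measureReal_absent hX hq _ hQ, inv_pow, ← div_eq_mul_inv,
        eq_div_iff (by positivity), ← pow_add, card_edgesIn_union, hk𝒮 S hS, hk𝒮 T hT]
      ring
    have hS : ∀ S ∈ 𝒮, ∑ T ∈ 𝒮, P.real (absent X (edgesIn S) ∩ absent X (edgesIn T))
        ≤ ((1 - q) ^ k.choose 2) ^ 2 * (3 / 2 * 𝒮.card) := by
      intro S hS
      rw [Finset.sum_congr rfl (hST S hS), ← Finset.mul_sum]
      gcongr
      refine (sum_pow_choose_card_inter_le W S k hW (hk𝒮 S hS) 𝒮 h𝒮 _ (by positivity)).trans ?_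
      nlinarith
    refine (Finset.sum_le_sum hS).trans (le_of_eq ?_)
    rw [Finset.sum_const, nsmul_eq_mul]; ring

end

/-! ### Choosing blocks almost free of dependencies -/

section
variable {V : Type*} [DecidableEq V]

theorem sum_card_filter_subset_le {α : Type*} (U : Finset V) (s a : ℕ) (hU : 0 < U.card)
    (hsU : s ≤ U.card) (R : Finset α) (g : α → Finset V) (hg : ∀ x ∈ R, a ≤ (g x).card) :
    ∑ W ∈ U.powersetCard s, ((R.filter fun x => g x ⊆ W).card : ℝ)
      ≤ U.card.choose s * (R.card * ((s : ℝ) / U.card) ^ a) := by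
  have hU' : (0 : ℝ) < U.card := by exact_mod_cast hU
  have hsU' : (s : ℝ) / U.card ≤ 1 := by
    rw [div_le_one hU']; exact_mod_cast hsU
  have := Finset.sum_card_bipartiteAbove_eq_sum_card_bipartiteBelow
    (s := U.powersetCard s) (t := R) (fun W x => g x ⊆ W)
  simp only [Finset.bipartiteAbove, Finset.bipartiteBelow] at this
  rw [← Nat.cast_sum, this, Nat.cast_sum, mul_left_comm, ← nsmul_eq_mul]
  refine Finset.sum_le_card_nsmul _ _ _ fun x hx => (card_filter_superset_le U (g x) s hU).trans ?_
  exact mul_le_mul_of_nonneg_left (pow_le_pow_of_le_one (by positivity) hsU' (hg x hx))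
    (by positivity)

/-- Averaging over the `s`-subsets `W` of `U`: some `W` contains at most the expected number of
members of two families of sets. -/
theorem exists_powersetCard_card_filter_subset_le {α β : Type*} (U : Finset V) (s a b : ℕ)
    (hU : 0 < U.card) (hsU : s ≤ U.card) (R : Finset α) (g : α → Finset V)
    (hg : ∀ x ∈ R, a ≤ (g x).card) (R' : Finset β) (g' : β → Finset V)
    (hg' : ∀ x ∈ R', b ≤ (g' x).card) :
    ∃ W ∈ U.powersetCard s,
      ((R.filter fun x => g x ⊆ W).card : ℝ) + (R'.filter fun x => g' x ⊆ W).card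
        ≤ R.card * ((s : ℝ) / U.card) ^ a + R'.card * ((s : ℝ) / U.card) ^ b := by
  refine Finset.exists_le_of_sum_le (Finset.powersetCard_nonempty.2 hsU) ?_
  rw [Finset.sum_add_distrib, Finset.sum_const, nsmul_eq_mul, Finset.card_powersetCard, mul_add]
  exact add_le_add (sum_card_filter_subset_le U s a hU hsU R g hg)
    (sum_card_filter_subset_le U s b hU hsU R' g' hg')

variable [Fintype V]

theorem card_filter_edgesIn_inter_le (W : Finset V) (k : ℕ) (hW : 0 < W.card)
    (R : Finset (PotentialEdge V)) :
    (((W.powersetCard k).filter fun S => ¬ edgesIn S ∩ R = ∅).card : ℝ)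
      ≤ W.card.choose k * (R.card * ((k : ℝ) / W.card) ^ 2) := by
  have hsub : ((W.powersetCard k).filter fun S => ¬ edgesIn S ∩ R = ∅) ⊆
      R.biUnion fun e => (W.powersetCard k).filter ((e : Sym2 V).toFinset ⊆ ·) := by
    intro S hS
    obtain ⟨hSW, hne⟩ := Finset.mem_filter.1 hS
    obtain ⟨e, he⟩ := Finset.nonempty_iff_ne_empty.2 hne
    obtain ⟨heS, heR⟩ := Finset.mem_inter.1 he
    exact Finset.mem_biUnion.2 ⟨e, heR, Finset.mem_filter.2 ⟨hSW, mem_edgesIn.1 heS⟩⟩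
  have h1 : (((W.powersetCard k).filter fun S => ¬ edgesIn S ∩ R = ∅).card : ℝ) ≤ _ :=
    Nat.cast_le.2 ((Finset.card_le_card hsub).trans Finset.card_biUnion_le)
  refine h1.trans ?_
  rw [Nat.cast_sum, mul_left_comm, ← nsmul_eq_mul]
  refine Finset.sum_le_card_nsmul _ _ _ fun e _ => ?_
  have := card_filter_superset_le W (e : Sym2 V).toFinset k hW
  rwa [card_toFinset] at this

/-- Given a set `A` of potential edges that is already in use, some `s`-subset `W` of `U` is such
that at least half of its `k`-subsets avoid `A`, the dependency neighbours of `A` and all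
dependencies inside `W`: the expected number of pairs that have to be avoided in a random `W` is
small. -/
theorem exists_block (H : SimpleGraph (PotentialEdge V)) (d : ℕ)
    (hd : ∀ e, (H.neighborSet e).encard ≤ d) (U : Finset V) (A : Finset (PotentialEdge V))
    (k s : ℕ) (hs : 0 < s) (hsU : s ≤ U.card)
    (hA : ((d : ℝ) + 1) * A.card * k ^ 2 / U.card ^ 2 + d * s * k ^ 2 / U.card ≤ 1 / 2) :
    ∃ W ⊆ U, W.card = s ∧ ∃ 𝒮 ⊆ W.powersetCard k, (W.card.choose k : ℝ) ≤ 2 * 𝒮.card ∧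
      ∀ S ∈ 𝒮, ∀ e ∈ edgesIn S,
        e ∉ A ∧ (∀ a ∈ A, ¬ H.Adj a e) ∧ ∀ f ∈ edgesIn W, ¬ H.Adj e f := by
  classical
  have hU : 0 < U.card := by omega
  have hU' : (0 : ℝ) < U.card := by exact_mod_cast hU
  have hs' : (0 : ℝ) < s := by exact_mod_cast hs
  have hnb : ∀ e, (Finset.univ.filter (H.Adj e)).card ≤ d := fun e => by
    have := hd e
    have h2 : H.neighborSet e = ((Finset.univ.filter (H.Adj e) : Finset _) : Set _) := by
      ext f; simp
    rw [h2, Set.encard_coe_eq_coe_finsetCard] at this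
    exact_mod_cast this
  -- `B`: the pairs in use and their dependency neighbours; `Q`: the dependent pairs of pairs in `U`,
  -- each of which spans at least three vertices
  set B := A ∪ A.biUnion fun a => Finset.univ.filter (H.Adj a) with hB
  have hBcard : (B.card : ℝ) ≤ (d + 1) * A.card := by
    have : B.card ≤ A.card + A.card * d :=
      (Finset.card_union_le _ _).trans (Nat.add_le_add_left
        (Finset.card_biUnion_le_card_mul _ _ _ fun a _ => hnb a) _)
    have h2 : (B.card : ℝ) ≤ A.card + A.card * d := by exact_mod_cast this
    linarith
  set Q := (edgesIn U).sigma fun e => Finset.univ.filter (H.Adj e) with hQ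
  have hQcard : (Q.card : ℝ) ≤ U.card ^ 2 * d := by
    have : Q.card ≤ U.card ^ 2 * d := by
      rw [hQ, Finset.card_sigma]
      refine (Finset.sum_le_card_nsmul _ _ d fun e _ => hnb e).trans ?_
      rw [smul_eq_mul]
      exact Nat.mul_le_mul_right _ (card_edgesIn_le U)
    exact_mod_cast this
  let hull : (Σ _ : PotentialEdge V, PotentialEdge V) → Finset V :=
    fun x => (x.1 : Sym2 V).toFinset ∪ (x.2 : Sym2 V).toFinset
  set M : ℝ := B.card * ((s : ℝ) / U.card) ^ 2 + Q.card * ((s : ℝ) / U.card) ^ 3 with hM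
  obtain ⟨W, hW, hbad⟩ := exists_powersetCard_card_filter_subset_le U s 2 3 hU hsU B
    (fun (e : PotentialEdge V) => (e : Sym2 V).toFinset) (fun e _ => (card_toFinset e).ge) Q hull
    fun x hx => by
      rw [hQ, Finset.mem_sigma, Finset.mem_filter] at hx
      exact three_le_card_union hx.2.2.ne
  obtain ⟨hWU, hWs⟩ := Finset.mem_powersetCard.1 hW
  have hW0 : 0 < W.card := by omega
  set R := (B.filter fun (e : PotentialEdge V) => (e : Sym2 V).toFinset ⊆ W) ∪
    (Q.filter fun x => hull x ⊆ W).image Sigma.fst with hR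
  have hRM : (R.card : ℝ) ≤ M := by
    refine le_trans ?_ hbad
    have := (Finset.card_union_le _ _).trans (Nat.add_le_add_left (Finset.card_image_le
      (s := Q.filter fun x => hull x ⊆ W) (f := Sigma.fst))
      (B.filter fun (e : PotentialEdge V) => (e : Sym2 V).toFinset ⊆ W).card)
    exact_mod_cast this
  have hMk : M * ((k : ℝ) / W.card) ^ 2 ≤ 1 / 2 := by
    refine le_trans ?_ hA
    have hM' : M ≤ ((d : ℝ) + 1) * A.card * ((s : ℝ) / U.card) ^ 2
        + U.card ^ 2 * d * ((s : ℝ) / U.card) ^ 3 := by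
      rw [hM]; gcongr
    refine (mul_le_mul_of_nonneg_right hM' (by positivity)).trans (le_of_eq ?_)
    rw [hWs]
    field_simp
  refine ⟨W, hWU, hWs, (W.powersetCard k).filter fun S => edgesIn S ∩ R = ∅,
    Finset.filter_subset _ _, ?_, ?_⟩
  · have hfew := card_filter_edgesIn_inter_le W k hW0 R
    have hhalf : (W.card.choose k : ℝ) * (R.card * ((k : ℝ) / W.card) ^ 2)
        ≤ W.card.choose k * (1 / 2) := by
      gcongr
      exact (mul_le_mul_of_nonneg_right hRM (by positivity)).trans hMk
    have htot := Finset.card_filter_add_card_filter_not (s := W.powersetCard k)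
      fun S => edgesIn S ∩ R = ∅
    rw [Finset.card_powersetCard] at htot
    rw [← htot] at hfew hhalf ⊢
    push_cast at hfew hhalf ⊢
    linarith
  · intro S hS e he
    obtain ⟨hSW, hSR⟩ := Finset.mem_filter.1 hS
    have heS := mem_edgesIn.1 he
    have heW := heS.trans (Finset.mem_powersetCard.1 hSW).1
    have heR : e ∉ R := fun heR =>
      Finset.notMem_empty e (hSR ▸ Finset.mem_inter.2 ⟨he, heR⟩)
    rw [hR, Finset.mem_union, not_or] at heR
    have heB : e ∉ B := fun heB => heR.1 (Finset.mem_filter.2 ⟨heB, heW⟩)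
    rw [hB, Finset.mem_union, not_or] at heB
    refine ⟨heB.1, fun a ha hadj => heB.2 ?_, fun f hf hadj => heR.2 ?_⟩
    · exact Finset.mem_biUnion.2 ⟨a, ha, Finset.mem_filter.2 ⟨Finset.mem_univ _, hadj⟩⟩
    · refine Finset.mem_image.2 ⟨⟨e, f⟩, Finset.mem_filter.2 ⟨?_, ?_⟩, rfl⟩
      · exact Finset.mem_sigma.2 ⟨mem_edgesIn.2 (heW.trans hWU),
          Finset.mem_filter.2 ⟨Finset.mem_univ _, hadj⟩⟩
      · exact Finset.union_subset heW (mem_edgesIn.1 hf)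

end

/-! ### Exponentially small failure probability -/

section
variable {V : Type*} [Fintype V] [DecidableEq V] {Ω : Type*} [MeasurableSpace Ω]
  {P : Measure Ω} [IsProbabilityMeasure P]
  {X : PotentialEdge V → Ω → Prop} {H : SimpleGraph (PotentialEdge V)}

/-- As long as the pairs `A` in use are few, a new block can be chosen whose useful pairs form,
together with `A`, an independent set of the dependency graph; the failure of the new block is then
independent of the failure of all previous ones, so that every block halves the probability. -/
theorem IsDependencyGraph.exists_event_of_blocks (h : IsDependencyGraph P X H)
    (hX : ∀ e, Measurable (X e)) {q : ℝ} (hq : ∀ e, P.real {ω | X e ω} = q) (hq1 : q < 1)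
    {d : ℕ} (hd : ∀ e, (H.neighborSet e).encard ≤ d) (U : Finset V) (k s t : ℕ)
    (hs : 0 < s) (hsU : s ≤ U.card) (hk : k ≤ s)
    (hA : ((d : ℝ) + 1) * (t * s ^ 2) * k ^ 2 / U.card ^ 2 + d * s * k ^ 2 / U.card ≤ 1 / 2)
    (hsum : ∑ v ∈ Finset.Icc 2 k, k.choose v * ((k : ℝ) / s) ^ v * (1 - q)⁻¹ ^ v.choose 2
      ≤ 1 / 4) :
    ∀ i ≤ t, ∃ (A : Finset (PotentialEdge V)) (D : Set Ω), A.card ≤ i * s ^ 2 ∧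
      (∀ e ∈ A, ∀ f ∈ A, ¬ H.Adj e f) ∧ MeasurableSet[sigmaOf X A] D ∧
      P.real D ≤ (1 / 2) ^ i ∧
      {ω | ∀ S ⊆ U, S.card = k → ω ∉ absent X (edgesIn S)} ⊆ D := by
  intro i
  induction i with
  | zero => exact fun _ => ⟨∅, Set.univ, by simp, by simp, MeasurableSet.univ, by simp, by simp⟩
  | succ i ih =>
    intro hi
    obtain ⟨A, D, hAcard, hAind, hDmeas, hDP, hDsub⟩ := ih (by omega)
    have hAt : (A.card : ℝ) ≤ t * s ^ 2 := by
      have : A.card ≤ t * s ^ 2 := hAcard.trans (Nat.mul_le_mul_right _ (by omega))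
      exact_mod_cast this
    obtain ⟨W, hWU, hWs, 𝒮, h𝒮, hcard, hgood⟩ := exists_block H d hd U A k s hs hsU
      (le_trans (by gcongr) hA)
    set E : Finset (PotentialEdge V) := 𝒮.biUnion edgesIn with hE
    have hEmem : ∀ e ∈ E, ∃ S ∈ 𝒮, e ∈ edgesIn S := fun e he => Finset.mem_biUnion.1 he
    have hsubW : ∀ S ∈ 𝒮, S ⊆ W := fun S hS => (Finset.mem_powersetCard.1 (h𝒮 hS)).1
    have hEW : E ⊆ edgesIn W := fun e he => by
      obtain ⟨S, hS, heS⟩ := hEmem e he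
      exact edgesIn_mono (hsubW S hS) heS
    have hdisj : Disjoint A E := Finset.disjoint_right.2 fun e he => by
      obtain ⟨S, hS, heS⟩ := hEmem e he
      exact (hgood S hS e heS).1
    have hind : ∀ e ∈ A ∪ E, ∀ f ∈ A ∪ E, ¬ H.Adj e f := by
      intro e he f hf
      rcases Finset.mem_union.1 he with he | he <;> rcases Finset.mem_union.1 hf with hf | hf
      · exact hAind e he f hf
      · obtain ⟨S, hS, hfS⟩ := hEmem f hf
        exact (hgood S hS f hfS).2.1 e he
      · obtain ⟨S, hS, heS⟩ := hEmem e he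
        exact fun hadj => (hgood S hS e heS).2.1 f hf hadj.symm
      · obtain ⟨S, hS, heS⟩ := hEmem e he
        exact (hgood S hS e heS).2.2 f (hEW hf)
    set F : Set Ω := ⋂ S ∈ 𝒮, (absent X (edgesIn S))ᶜ with hF
    have hFmeas : MeasurableSet[sigmaOf X E] F :=
      Finset.measurableSet_biInter _ fun S hS =>
        (measurableSet_sigmaOf_absent (Finset.subset_biUnion_of_mem edgesIn hS)).compl
    have hFP : P.real F ≤ 1 / 2 := by
      refine h.measureReal_no_absent_le hX hq hq1 W k (by omega) (by omega) 𝒮 h𝒮 ?_ hcard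
        (by rw [hWs]; exact hsum)
      exact fun S hS T hT e he f hf => (hgood S hS e he).2.2 f (edgesIn_mono (hsubW T hT) hf)
    refine ⟨A ∪ E, D ∩ F, ?_, hind, ?_, ?_, ?_⟩
    · have h1 := (Finset.card_le_card hEW).trans (card_edgesIn_le W)
      rw [hWs] at h1
      have h2 := Finset.card_union_le A E
      rw [add_mul, one_mul]
      omega
    · exact MeasurableSet.inter (sigmaOf_mono Finset.subset_union_left _ hDmeas)
        (sigmaOf_mono Finset.subset_union_right _ hFmeas)
    · have hDF := (Indep_iff _ _ _).1 (h.indep_sigmaOf hX hdisj hind) D F hDmeas hFmeas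
      rw [measureReal_def, hDF, ENNReal.toReal_mul, pow_succ]
      exact mul_le_mul hDP hFP measureReal_nonneg (by positivity)
    · intro ω hω
      refine ⟨hDsub hω, Set.mem_iInter₂.2 fun S hS => ?_⟩
      exact hω S ((hsubW S hS).trans hWU) (Finset.mem_powersetCard.1 (h𝒮 hS)).2

/-- The union bound over all `m`-sets of vertices. -/
theorem IsDependencyGraph.measureReal_exists_no_indepSet_le (h : IsDependencyGraph P X H)
    (hX : ∀ e, Measurable (X e)) {q : ℝ} (hq : ∀ e, P.real {ω | X e ω} = q) (hq1 : q < 1)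
    {d : ℕ} (hd : ∀ e, (H.neighborSet e).encard ≤ d) (k m s t : ℕ)
    (hs : 0 < s) (hsm : s ≤ m) (hk : k ≤ s)
    (hA : ((d : ℝ) + 1) * (t * s ^ 2) * k ^ 2 / m ^ 2 + d * s * k ^ 2 / m ≤ 1 / 2)
    (hsum : ∑ v ∈ Finset.Icc 2 k, k.choose v * ((k : ℝ) / s) ^ v * (1 - q)⁻¹ ^ v.choose 2
      ≤ 1 / 4) :
    P.real {ω | ∃ U : Finset V, U.card = m ∧
      ∀ S ⊆ U, S.card = k → ω ∉ absent X (edgesIn S)} ≤ 2 ^ Fintype.card V * (1 / 2) ^ t := by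
  have hsub : {ω | ∃ U : Finset V, U.card = m ∧
      ∀ S ⊆ U, S.card = k → ω ∉ absent X (edgesIn S)} ⊆
      ⋃ U ∈ (Finset.univ : Finset V).powersetCard m,
        {ω | ∀ S ⊆ U, S.card = k → ω ∉ absent X (edgesIn S)} := by
    rintro ω ⟨U, hU, hω⟩
    exact Set.mem_iUnion₂.2 ⟨U, Finset.mem_powersetCard.2 ⟨Finset.subset_univ _, hU⟩, hω⟩
  refine (measureReal_mono hsub (measure_ne_top P _)).trans
    ((measureReal_biUnion_finset_le _ _).trans ?_)
  have hU : ∀ U ∈ (Finset.univ : Finset V).powersetCard m,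
      P.real {ω | ∀ S ⊆ U, S.card = k → ω ∉ absent X (edgesIn S)} ≤ (1 / 2) ^ t := by
    intro U hU
    obtain rfl := (Finset.mem_powersetCard.1 hU).2
    obtain ⟨A, D, -, -, -, hD, hsub⟩ := h.exists_event_of_blocks hX hq hq1 hd U k s t hs hsm hk
      hA hsum t le_rfl
    exact (measureReal_mono hsub).trans hD
  refine (Finset.sum_le_card_nsmul _ _ _ hU).trans ?_
  rw [nsmul_eq_mul, Finset.card_powersetCard, Finset.card_univ]
  gcongr
  exact_mod_cast Nat.choose_le_two_pow _ _

end

theorem isIndepSet_of_mem_absent {Ω V : Type*} [Fintype V] [DecidableEq V]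
    {G : Ω → SimpleGraph V} {S : Finset V} {ω : Ω}
    (h : ω ∈ absent (edgeIndicator G) (edgesIn S)) : (G ω).IsIndepSet (S : Set V) := by
  intro v hv w hw hvw hadj
  refine mem_absent.1 h ⟨s(v, w), by simpa using hvw⟩ (mem_edgesIn.2 ?_) ?_
  · simpa [Sym2.toFinset_mk_eq, Finset.insert_subset_iff] using And.intro hv hw
  · simpa [edgeIndicator] using hadj

/-! ### The choice of the parameters -/

theorem pow_choose_two_le {r Z : ℝ} {k v : ℕ} {c : ℝ} (hr : 1 ≤ r) (hZ : Z = Real.exp (c / 2))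
    (hk : Real.log r * (k - 1) ≤ c) (hv : v ≤ k) : r ^ v.choose 2 ≤ Z ^ v := by
  have hr0 : 0 < r := by linarith
  have hl := Real.log_nonneg hr
  rw [← Real.exp_log hr0, hZ, ← Real.exp_nat_mul, ← Real.exp_nat_mul, Real.exp_le_exp,
    Nat.cast_choose_two]
  have hvk : (v : ℝ) ≤ k := by exact_mod_cast hv
  have h1 : Real.log r * (v - 1) ≤ c := le_trans (by gcongr) hk
  have h2 : (v : ℝ) * (Real.log r * (v - 1)) ≤ v * c := by gcongr
  linarith

/-- The sum of the second moment method is small once `k² Z / s` is. -/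
theorem sum_overlap_le {r Z y : ℝ} {k s : ℕ} {c : ℝ} (hr : 1 ≤ r) (hZ : Z = Real.exp (c / 2))
    (hk : Real.log r * (k - 1) ≤ c) (hy : (k : ℝ) ^ 2 * Z / s ≤ y) (hy1 : y ≤ 1)
    (hky : (k : ℝ) * y ^ 2 ≤ 1 / 4) :
    ∑ v ∈ Finset.Icc 2 k, k.choose v * ((k : ℝ) / s) ^ v * r ^ v.choose 2 ≤ 1 / 4 := by
  have hZ0 : 0 < Z := hZ ▸ Real.exp_pos _
  have hy0 : 0 ≤ y := le_trans (by positivity) hy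
  have hv : ∀ v ∈ Finset.Icc 2 k,
      k.choose v * ((k : ℝ) / s) ^ v * r ^ v.choose 2 ≤ y ^ 2 := by
    intro v hv
    obtain ⟨h2v, hvk⟩ := Finset.mem_Icc.1 hv
    calc (k.choose v : ℝ) * ((k : ℝ) / s) ^ v * r ^ v.choose 2
        ≤ (k : ℝ) ^ v * ((k : ℝ) / s) ^ v * Z ^ v := by
          gcongr
          · exact_mod_cast Nat.choose_le_pow k v
          · exact pow_choose_two_le hr hZ hk hvk
      _ = ((k : ℝ) ^ 2 * Z / s) ^ v := by rw [← mul_pow, ← mul_pow]; congr 1; ring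
      _ ≤ y ^ v := by gcongr
      _ ≤ y ^ 2 := pow_le_pow_of_le_one hy0 hy1 h2v
  refine (Finset.sum_le_card_nsmul _ _ _ hv).trans (le_trans ?_ hky)
  rw [nsmul_eq_mul, Nat.card_Icc]
  gcongr
  omega

theorem eventually_parameter_bounds (ε : ℝ) (hε : 0 < ε) :
    ∀ᶠ n : ℕ in atTop, (1 : ℝ) < n ∧ Real.log n + 1 ≤ (n : ℝ) ^ (ε / 32) ∧
      160 ≤ (n : ℝ) ^ (ε / 8) ∧ 2 * Real.log n < ε * (n : ℝ) ^ (ε / 8) := by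
  have hreal : ∀ᶠ x : ℝ in atTop, 1 < x ∧ Real.log x + 1 ≤ x ^ (ε / 32) ∧
      160 ≤ x ^ (ε / 8) ∧ 2 * Real.log x < ε * x ^ (ε / 8) := by
    have h1 := (isLittleO_log_rpow_atTop (show 0 < ε / 32 by positivity)).bound
      (show (0 : ℝ) < 1 / 2 by norm_num)
    have h2 := (isLittleO_log_rpow_atTop (show 0 < ε / 8 by positivity)).bound
      (show (0 : ℝ) < ε / 4 by positivity)
    filter_upwards [h1, h2, eventually_gt_atTop 1,
      (tendsto_rpow_atTop (show 0 < ε / 32 by positivity)).eventually_ge_atTop 2,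
      (tendsto_rpow_atTop (show 0 < ε / 8 by positivity)).eventually_ge_atTop 160]
      with x h1 h2 hx h3 h4
    have hl : 0 ≤ Real.log x := Real.log_nonneg hx.le
    rw [Real.norm_of_nonneg hl, Real.norm_of_nonneg (by positivity)] at h1 h2
    exact ⟨hx, by linarith, h4, by nlinarith⟩
  exact (tendsto_natCast_atTop_atTop (R := ℝ)).eventually hreal

/-- Admissible sizes: `k` of the independent sets, `m` of the remainder that is coloured trivially,
`s` of the blocks and `t` for their number. Up to rounding, `k` is
`(1 - 2ε) log n / log (1 / p)`, while `m = n ^ (1 - ε / 8)`, `s = n ^ (1 / 2 - 3ε / 4)` and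
`t = 4 n ^ (1 + ε)`. -/
theorem exists_parameters {ε : ℝ} (hε0 : 0 < ε) (hε1 : ε < 1 / 8) {n : ℕ} (hn : (1 : ℝ) < n)
    (hlog : Real.log n + 1 ≤ (n : ℝ) ^ (ε / 32)) (hpow : 160 ≤ (n : ℝ) ^ (ε / 8))
    (hlog' : 2 * Real.log n < ε * (n : ℝ) ^ (ε / 8)) {p : ℝ} (hp0 : 0 < p) (hp : p < 1 / 4)
    {d : ℕ} (hd : (d : ℝ) ≤ (n : ℝ) ^ (ε / 16)) :
    ∃ k m s t : ℕ, 0 < k ∧ 0 < s ∧ s ≤ m ∧ k ≤ s ∧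
      ((d : ℝ) + 1) * (t * s ^ 2) * k ^ 2 / m ^ 2 + d * s * k ^ 2 / m ≤ 1 / 2 ∧
      ∑ v ∈ Finset.Icc 2 k, k.choose v * ((k : ℝ) / s) ^ v * p⁻¹ ^ v.choose 2 ≤ 1 / 4 ∧
      (n : ℝ) / k + m < (1 + 4 * ε) * (-(n : ℝ) * Real.log p / Real.log n) ∧
      2 ^ n * (1 / 2 : ℝ) ^ t < Real.exp (-(n : ℝ) ^ (1 + ε)) := by
  set x : ℝ := (n : ℝ) with hx
  have hx0 : 0 < x := by linarith
  set L := Real.log x with hL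
  have hL0 : 0 < L := Real.log_pos hn
  set l := Real.log p⁻¹ with hl
  have hl1 : 1 ≤ l := by
    rw [hl, Real.le_log_iff_exp_le (by positivity)]
    have h4 : 4 ≤ p⁻¹ := by
      rw [le_inv_comm₀ (by norm_num) hp0]; linarith
    linarith [Real.exp_one_lt_d9]
  have one_le : ∀ {a : ℝ}, 0 ≤ a → 1 ≤ x ^ a := fun ha => Real.one_le_rpow hn.le ha
  have hmono : ∀ {a b : ℝ}, a ≤ b → x ^ a ≤ x ^ b := fun hab =>
    Real.rpow_le_rpow_of_exponent_le hn.le hab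
  have ceil_le : ∀ {y : ℝ}, 1 ≤ y → (⌈y⌉₊ : ℝ) ≤ y + 1 := fun {y} hy =>
    (Nat.ceil_lt_add_one (by linarith)).le
  -- Rounding `k` up costs nothing, since only `k - 1` enters the bound on the overlaps.
  set k := ⌊(1 - 2 * ε) * L / l⌋₊ + 1 with hk
  set m := ⌈x ^ (1 - ε / 8)⌉₊ with hm
  set s := ⌈x ^ (1 / 2 - 3 * ε / 4)⌉₊ with hs
  set t := ⌈4 * x ^ (1 + ε)⌉₊ with ht
  have hfrac0 : 0 ≤ (1 - 2 * ε) * L / l := by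
    have : 0 ≤ 1 - 2 * ε := by linarith
    positivity
  have hkl : l * ((k : ℝ) - 1) ≤ (1 - 2 * ε) * L := by
    have := Nat.floor_le hfrac0
    rw [le_div_iff₀ (by linarith)] at this
    rw [hk]; push_cast; linarith
  have hkL : (1 - 2 * ε) * L < k * l := by
    have := Nat.lt_floor_add_one ((1 - 2 * ε) * L / l)
    rw [div_lt_iff₀ (by linarith)] at this
    rw [hk]; push_cast; linarith
  have hk1 : (1 : ℝ) ≤ k := by exact_mod_cast Nat.succ_pos ⌊(1 - 2 * ε) * L / l⌋₊
  have hkK : (k : ℝ) ≤ x ^ (ε / 32) := by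
    have h1 : (k : ℝ) - 1 ≤ l * (k - 1) := le_mul_of_one_le_left (by linarith) hl1
    have h2 : (1 - 2 * ε) * L ≤ L := mul_le_of_le_one_left hL0.le (by linarith)
    linarith
  have hk2 : (k : ℝ) ^ 2 ≤ x ^ (ε / 16) := by
    calc (k : ℝ) ^ 2 ≤ (x ^ (ε / 32)) ^ 2 := by gcongr
      _ = x ^ (ε / 16) := by
        rw [← Real.rpow_natCast, ← Real.rpow_mul hx0.le]; congr 1; push_cast; ring
  have hmlo : x ^ (1 - ε / 8) ≤ m := Nat.le_ceil _
  have hmhi : (m : ℝ) ≤ 2 * x ^ (1 - ε / 8) := by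
    have := one_le (a := 1 - ε / 8) (by linarith)
    linarith [ceil_le this]
  have hslo : x ^ (1 / 2 - 3 * ε / 4) ≤ s := Nat.le_ceil _
  have hshi : (s : ℝ) ≤ 2 * x ^ (1 / 2 - 3 * ε / 4) := by
    have := one_le (a := 1 / 2 - 3 * ε / 4) (by linarith)
    linarith [ceil_le this]
  have htlo : 4 * x ^ (1 + ε) ≤ t := Nat.le_ceil _
  have hthi : (t : ℝ) ≤ 5 * x ^ (1 + ε) := by
    have := one_le (a := 1 + ε) (by linarith)
    linarith [ceil_le (y := 4 * x ^ (1 + ε)) (by linarith)]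
  have hd1 : (d : ℝ) + 1 ≤ 2 * x ^ (ε / 16) := by
    linarith [one_le (a := ε / 16) (by linarith)]
  have hsmall : x ^ (-(ε / 8)) ≤ 1 / 160 := by
    rw [Real.rpow_neg hx0.le, inv_le_comm₀ (by positivity) (by norm_num)]
    linarith
  have hm0 : (0 : ℝ) < m := lt_of_lt_of_le (by positivity) hmlo
  have hs0 : (0 : ℝ) < s := lt_of_lt_of_le (by positivity) hslo
  refine ⟨k, m, s, t, Nat.succ_pos _, by exact_mod_cast hs0, ?_, ?_, ?_, ?_, ?_, ?_⟩
  · exact Nat.ceil_le_ceil (hmono (by linarith))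
  · have : (k : ℝ) ≤ s := hkK.trans ((hmono (by linarith)).trans hslo)
    exact_mod_cast this
  · have h1 : ((d : ℝ) + 1) * (t * s ^ 2) * k ^ 2 / m ^ 2 ≤ 1 / 4 := by
      calc ((d : ℝ) + 1) * (t * s ^ 2) * k ^ 2 / m ^ 2
          ≤ (2 * x ^ (ε / 16)) * ((5 * x ^ (1 + ε)) * (2 * x ^ (1 / 2 - 3 * ε / 4)) ^ 2)
            * x ^ (ε / 16) / (x ^ (1 - ε / 8)) ^ 2 := by gcongr
        _ = 40 * (x ^ (ε / 16) * x ^ (1 + ε) * (x ^ (1 / 2 - 3 * ε / 4)) ^ 2 * x ^ (ε / 16)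
            / (x ^ (1 - ε / 8)) ^ 2) := by ring
        _ = 40 * x ^ (-(ε / 8)) := by
          rw [← Real.rpow_natCast (x ^ (1 / 2 - 3 * ε / 4)),
            ← Real.rpow_natCast (x ^ (1 - ε / 8)), ← Real.rpow_mul hx0.le, ← Real.rpow_mul hx0.le,
            ← Real.rpow_add hx0, ← Real.rpow_add hx0, ← Real.rpow_add hx0, ← Real.rpow_sub hx0]
          congr 2; push_cast; ring
        _ ≤ 1 / 4 := by linarith
    have h2 : (d : ℝ) * s * k ^ 2 / m ≤ 1 / 4 := by
      calc (d : ℝ) * s * k ^ 2 / m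
          ≤ x ^ (ε / 16) * (2 * x ^ (1 / 2 - 3 * ε / 4)) * x ^ (ε / 16) / x ^ (1 - ε / 8) := by
            gcongr
        _ = 2 * (x ^ (ε / 16) * x ^ (1 / 2 - 3 * ε / 4) * x ^ (ε / 16) / x ^ (1 - ε / 8)) := by
            ring
        _ = 2 * x ^ (-(1 / 2) - ε / 2) := by
          rw [← Real.rpow_add hx0, ← Real.rpow_add hx0, ← Real.rpow_sub hx0]
          congr 2; ring
        _ ≤ 2 * x ^ (-(ε / 8)) := by
          have := hmono (show -(1 / 2) - ε / 2 ≤ -(ε / 8) by linarith)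
          linarith
        _ ≤ 1 / 4 := by linarith
    linarith
  · refine sum_overlap_le (Z := x ^ (1 / 2 - ε)) (y := x ^ (-(3 * ε / 16)))
      (c := (1 - 2 * ε) * L) ?_ ?_ hkl ?_ ?_ ?_
    · rw [one_le_inv₀ hp0]; linarith
    · rw [Real.rpow_def_of_pos hx0]; congr 1; ring
    · calc (k : ℝ) ^ 2 * x ^ (1 / 2 - ε) / s
          ≤ x ^ (ε / 16) * x ^ (1 / 2 - ε) / x ^ (1 / 2 - 3 * ε / 4) := by gcongr
        _ = x ^ (-(3 * ε / 16)) := by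
          rw [← Real.rpow_add hx0, ← Real.rpow_sub hx0]; congr 1; ring
    · exact Real.rpow_le_one_of_one_le_of_nonpos hn.le (by linarith)
    · calc (k : ℝ) * (x ^ (-(3 * ε / 16))) ^ 2
          ≤ x ^ (ε / 32) * (x ^ (-(3 * ε / 16))) ^ 2 := by gcongr
        _ = x ^ (ε / 32 + -(3 * ε / 16) * (2 : ℕ)) := by
          rw [← Real.rpow_natCast, ← Real.rpow_mul hx0.le, ← Real.rpow_add hx0]
        _ ≤ x ^ (-(ε / 8)) := hmono (by push_cast; linarith)
        _ ≤ 1 / 4 := by linarith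
  · have hlp : -x * Real.log p / L = x * l / L := by
      rw [hl, Real.log_inv]; ring
    rw [hlp]
    have h1 : x / k ≤ (1 + 3 * ε) * (x * l / L) := by
      rw [div_le_iff₀ (by linarith), show (1 + 3 * ε) * (x * l / L) * k
        = x * ((1 + 3 * ε) * (k * l) / L) by ring]
      refine le_mul_of_one_le_right hx0.le ?_
      rw [one_le_div hL0]
      -- `1 / (1 - 2ε) ≤ 1 + 3ε`, as `ε ≤ 1 / 6`
      have h3 : 1 ≤ (1 + 3 * ε) * (1 - 2 * ε) := by
        have h4 : 0 ≤ ε * (1 - 6 * ε) := mul_nonneg hε0.le (by linarith)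
        linarith
      calc L = 1 * L := (one_mul L).symm
        _ ≤ (1 + 3 * ε) * (1 - 2 * ε) * L := by gcongr
        _ = (1 + 3 * ε) * ((1 - 2 * ε) * L) := by ring
        _ ≤ (1 + 3 * ε) * (k * l) := by gcongr
    have h2 : (m : ℝ) < ε * (x * l / L) := by
      refine hmhi.trans_lt ?_
      rw [show ε * (x * l / L) = ε * (x * l) / L by ring, lt_div_iff₀ hL0]
      have hxx : x ^ (1 - ε / 8) * x ^ (ε / 8) = x := by
        rw [← Real.rpow_add hx0]; simp
      have hpos : 0 < x ^ (1 - ε / 8) := by positivity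
      calc 2 * x ^ (1 - ε / 8) * L = x ^ (1 - ε / 8) * (2 * L) := by ring
        _ < x ^ (1 - ε / 8) * (ε * x ^ (ε / 8)) := by gcongr
        _ = ε * (x ^ (1 - ε / 8) * x ^ (ε / 8)) := by ring
        _ = ε * (x * 1) := by rw [hxx, mul_one]
        _ ≤ ε * (x * l) := by gcongr
    linarith
  · have hxle : x ≤ x ^ (1 + ε) := by
      calc x = x ^ (1 : ℝ) := (Real.rpow_one x).symm
        _ ≤ _ := hmono (by linarith)
    have h2 : (2 : ℝ) ^ n * (1 / 2) ^ t = Real.exp (Real.log 2 * (x - t)) := by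
      rw [mul_sub, Real.exp_sub, mul_comm _ x, mul_comm _ (t : ℝ), hx, Real.exp_nat_mul,
        Real.exp_nat_mul, Real.exp_log (by norm_num), one_div, inv_pow, div_eq_mul_inv]
    rw [h2, Real.exp_lt_exp]
    have h3 := Real.log_two_gt_d9
    have h4 : Real.log 2 * (3 * x ^ (1 + ε)) ≤ Real.log 2 * (t - x) := by
      gcongr
      linarith
    have h5 : 0.6 * (3 * x ^ (1 + ε)) ≤ Real.log 2 * (3 * x ^ (1 + ε)) := by
      gcongr
      linarith
    have h6 : 0 < x ^ (1 + ε) := by positivity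
    linarith

end DependentRandomGraph

theorem theorem2 (ε : ℝ) (hε0 : 0 < ε) (hε1 : ε < 1 / 8)
    (η : ℕ → ℝ) (hη : Tendsto η atTop (𝓝 0)) :
    ∃ n₀ : ℕ, ∀ n : ℕ, n₀ ≤ n →
      ∀ q : ℝ, 3 / 4 < q → q < 1 - (n : ℝ) ^ (-ε / 4) →
      ∀ d : ℕ, (d : ℝ) ≤ (n : ℝ) ^ (η n) →
      ∀ (Ω : Type*) [MeasurableSpace Ω] (P : Measure Ω) [IsProbabilityMeasure P]
        (G : Ω → SimpleGraph (Fin n)),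
        DependentRandomGraph.IsDependentRandomGraph P q d G →
        P.real {ω | (DependentRandomGraph.chi (G ω) : ℝ) <
            (1 + 4 * ε) * (-(n : ℝ) * Real.log (1 - q) / Real.log n)}
          > 1 - Real.exp (-(n : ℝ) ^ (1 + ε)) := by
  obtain ⟨n₀, hn₀⟩ := eventually_atTop.1
    ((DependentRandomGraph.eventually_parameter_bounds ε hε0).and
      (hη.eventually_le_const (show 0 < ε / 16 by positivity)))
  refine ⟨n₀, fun n hn q hq hq' d hd Ω _ P _ G hG => ?_⟩
  obtain ⟨⟨hn1, hlog, hpow, hlog'⟩, hηn⟩ := hn₀ n hn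
  have hq1 : q < 1 := by
    have : 0 < (n : ℝ) ^ (-ε / 4) := Real.rpow_pos_of_pos (by linarith) _
    linarith
  have hd' : (d : ℝ) ≤ (n : ℝ) ^ (ε / 16) :=
    hd.trans (Real.rpow_le_rpow_of_exponent_le hn1.le hηn)
  obtain ⟨k, m, s, t, hk, hs, hsm, hks, hA, hsum, hχ, hexp⟩ :=
    DependentRandomGraph.exists_parameters hε0 hε1 hn1 hlog hpow hlog'
      (show 0 < 1 - q by linarith) (show 1 - q < 1 / 4 by linarith) hd'
  obtain ⟨H, hH, hdep⟩ := hG.locallyDependent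
  have hbad := hdep.measureReal_exists_no_indepSet_le hG.measurable_edge hG.edge_prob hq1 hH
    k m s t hs hsm hks hA hsum
  rw [Fintype.card_fin] at hbad
  set good : Set Ω := {ω | (DependentRandomGraph.chi (G ω) : ℝ) <
    (1 + 4 * ε) * (-(n : ℝ) * Real.log (1 - q) / Real.log n)} with hgood
  have hcover : (Set.univ : Set Ω) ⊆ good ∪ {ω | ∃ U : Finset (Fin n), U.card = m ∧
      ∀ S ⊆ U, S.card = k →
        ω ∉ DependentRandomGraph.absent (DependentRandomGraph.edgeIndicator G)
          (DependentRandomGraph.edgesIn S)} := by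
    intro ω _
    by_contra hω
    rw [Set.mem_union, not_or] at hω
    refine hω.1 (lt_of_le_of_lt
      (DependentRandomGraph.chi_le_of_indepSets (G ω) k m hk fun U hU => ?_) hχ)
    by_contra! hcon
    exact hω.2 ⟨U, hU, fun S hSU hSk hS =>
      hcon S hSU hSk (DependentRandomGraph.isIndepSet_of_mem_absent hS)⟩
  -- No measurability of the event in question is needed: subadditivity holds for outer measures.
  have h1 := (measureReal_mono (μ := P) hcover).trans (measureReal_union_le _ _)
  rw [probReal_univ] at h1
  linarith
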